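/- A \emph{graph model} $\mathcal{G}$ is given by its web, a pair $(G,i)$ consisting of a non-empty (hence infinite) set $G$ and an injective total function $i : G^*\times G\to G$, where $G^*$ is the set of finite subsets of $G$. Given an environment $\rho:\mathrm{Var}\to\mathcal{P}(G)$, where $\mathrm{Var}$ is the countably infinite set of variables, $\lambda$-terms are interpreted in $\mathcal{P}(G)$ by $$[\![x]\!]_\rho=\rho(x),\qquad [\![MN]\!]_\rho=\{\alpha\in G : \exists a\in G^*,\ a\subseteq[\![N]\!]_\rho,\ i(a,\alpha)\in[\![M]\!]_\rho\},$$ $$[\![\lambda x.M]\!]_\rho=\{i(a,\alpha) : a\in G^*,\ \alpha\in[\![M]\!]_{\rho[x:=a]}\}.$$ The \emph{order theory} (resp. \emph{equational theory}) of $\mathcal{G}$ is the set of all pairs $(M,N)$ of $\lambda$-terms such that $[\![M]\!]_\rho\subseteq[\![N]\!]_\rho$ (resp. $[\![M]\!]_\rho=[\![N]\!]_\rho$) for all environments $\rho$. \textbf{Theorem.} For every graph model $\mathcal{G}$ there is a graph model $\mathcal{G}'$ which has a countable web and the same order theory as $\mathcal{G}$, and hence also the same equational theory as $\mathcal{G}$.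 -/

import Mathlib

/-- Raw λ-terms over the countable set of variables `ℕ`. -/
inductive LambdaTerm : Type where
  | var : ℕ → LambdaTerm
  | app : LambdaTerm → LambdaTerm → LambdaTerm
  | lam : ℕ → LambdaTerm → LambdaTerm

universe u

/-- A graph model, given by its web: a nonempty set `Web` with an injection
`code : Web^* × Web → Web`, where `Web^*` is the set of finite subsets of `Web`. The underlying
domain of the model is the powerset `Set Web`, ordered by inclusion.
Such a web is automatically infinite, see `GraphModel.infinite_web`. -/
structure GraphModel where
  Web : Type u
  nonempty : Nonempty Web
  code : Finset Web × Web → Web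
  code_injective : Function.Injective code

namespace GraphModel

theorem infinite_web (G : GraphModel.{u}) : Infinite G.Web := by
  obtain ⟨x⟩ := G.nonempty
  refine not_finite_iff_infinite.mp fun hfin => ?_
  have h : Function.Injective fun X : Set G.Web => G.code (X.toFinite.toFinset, x) := by
    intro X Y hXY
    have := G.code_injective hXY
    simpa using this
  exact Function.cantor_injective _ h

variable (G : GraphModel.{u})

/-- Application on the domain `Set G.Web`. -/
def app (X Y : Set G.Web) : Set G.Web :=
  {α | ∃ a : Finset G.Web, (a : Set G.Web) ⊆ Y ∧ G.code (a, α) ∈ X}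

/-- The trace of a function on the domain: the element of the domain that represents it
(if it is Scott continuous). -/
def abs (f : Set G.Web → Set G.Web) : Set G.Web :=
  {γ | ∃ (a : Finset G.Web) (α : G.Web), α ∈ f (a : Set G.Web) ∧ γ = G.code (a, α)}

/-- Interpretation of a λ-term in the graph model under an environment `ρ`. -/
def interp : LambdaTerm → (ℕ → Set G.Web) → Set G.Web
  | .var x, ρ => ρ x
  | .app M N, ρ => G.app (interp M ρ) (interp N ρ)
  | .lam x M, ρ => G.abs fun X => interp M (Function.update ρ x X)

/-- The order theory of `G`: all pairs `(M, N)` such that `M ⊑ N` holds in `G`. -/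
def orderTheory : Set (LambdaTerm × LambdaTerm) :=
  {p | ∀ ρ : ℕ → Set G.Web, G.interp p.1 ρ ⊆ G.interp p.2 ρ}

/-- The equational theory of `G`: all pairs `(M, N)` such that `M = N` holds in `G`. -/
def eqTheory : Set (LambdaTerm × LambdaTerm) :=
  {p | ∀ ρ : ℕ → Set G.Web, G.interp p.1 ρ = G.interp p.2 ρ}

end GraphModel

/-!
This is a downward Löwenheim–Skolem argument. Relativize the interpretation of terms to a set `A` of
points by letting all finite sets and points in the clauses for application and abstraction range
over `A`. Since a derivation of `α ∈ ⟦M⟧ρ` mentions only finitely many points, it already lives in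
the relative interpretation for some finite set and some finite part of `ρ`. Closing a countable set
under codes and under such finite sets, for all terms and all finite environments over it, yields a
countable set `A` on which the relative interpretation is the restriction of the original one;
moreover it is the interpretation in the graph model with web `A`. If `A` is started from points
witnessing each of the countably many inequations that fail in `G`, these still fail on `A`.
-/

open Filter

universe v

section Closure

variable {W : Type*}

theorem countable_ofPred_finset_coe_subset {S : Set W} (hS : S.Countable) :
    {F : Finset W | (F : Set W) ⊆ S}.Countable := by
  simpa [Set.preimage] using
    (Set.countable_ofPred_finite_subset hS).preimage (Finset.coe_injective (α := W))

theorem exists_countable_superset_closed {Φ : Finset W → Set W} (hΦ : ∀ F, (Φ F).Countable)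
    {C : Set W} (hC : C.Countable) :
    ∃ A : Set W, A.Countable ∧ C ⊆ A ∧ ∀ F : Finset W, (F : Set W) ⊆ A → Φ F ⊆ A := by
  let step (S : Set W) : Set W := S ∪ ⋃ F ∈ {F : Finset W | (F : Set W) ⊆ S}, Φ F
  let stage (n : ℕ) : Set W := step^[n] C
  have stage_succ (n : ℕ) : stage (n + 1) = step (stage n) := Function.iterate_succ_apply' step n C
  have stage_mono : Monotone stage := monotone_nat_of_le_succ fun n => by
    rw [stage_succ]
    exact Set.subset_union_left
  have stage_countable (n : ℕ) : (stage n).Countable := by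
    induction n with
    | zero => exact hC
    | succ n ih =>
      rw [stage_succ]
      exact ih.union ((countable_ofPred_finset_coe_subset ih).biUnion fun F _ => hΦ F)
  refine ⟨⋃ n, stage n, Set.countable_iUnion stage_countable, Set.subset_iUnion stage 0,
    fun F hF => ?_⟩
  obtain ⟨n, hn⟩ := stage_mono.directed_le.exists_mem_subset_of_finset_subset_biUnion hF
  calc Φ F ⊆ step (stage n) := Set.subset_union_of_subset_right (Set.subset_biUnion_of_mem hn) _
    _ = stage (n + 1) := (stage_succ n).symm
    _ ⊆ ⋃ n, stage n := Set.subset_iUnion stage (n + 1)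

theorem exists_embedding_range_eq_of_countable {A : Set W} (hA : A.Countable) :
    ∃ (W' : Type) (f : W' ↪ W), Countable W' ∧ Set.range f = A := by
  have : Countable A := hA
  let e : Shrink.{0} A ≃ A := (equivShrink.{0} A).symm
  refine ⟨Shrink.{0} A, e.toEmbedding.trans (Function.Embedding.subtype _), e.countable_iff.2 this,
    ?_⟩
  rw [Function.Embedding.coe_trans, Equiv.coe_toEmbedding, e.surjective.range_comp]
  exact Subtype.range_coe

end Closure

instance : Countable LambdaTerm := by
  classical
  let Φ (F : Finset LambdaTerm) : Set LambdaTerm :=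
    Set.range .var ∪ Set.image2 .app F F ∪ Set.image2 .lam Set.univ F
  have Φ_countable (F : Finset LambdaTerm) : (Φ F).Countable :=
    ((Set.countable_range _).union (F.countable_toSet.image2 F.countable_toSet _)).union
      (Set.countable_univ.image2 F.countable_toSet _)
  obtain ⟨A, hA, -, Φ_subset⟩ := exists_countable_superset_closed Φ_countable Set.countable_empty
  have mem_A (M : LambdaTerm) : M ∈ A := by
    induction M with
    | var x => exact Φ_subset ∅ (by simp) (.inl (.inl ⟨x, rfl⟩))
    | app M N ihM ihN =>
      exact Φ_subset {M, N} (by simp [Set.insert_subset_iff, ihM, ihN])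
        (.inl (.inr ⟨M, by simp, N, by simp, rfl⟩))
    | lam x M ih => exact Φ_subset {M} (by simp [ih]) (.inr ⟨x, trivial, M, by simp, rfl⟩)
  exact Set.countable_univ_iff.1 (hA.mono fun M _ => mem_A M)

/-- The environment with graph `s`. Finite environments are those of the form `envOfGraph e` with
`e` a `Finset`, so that there are only countably many of them over a countable set. -/
def envOfGraph {W : Type*} (s : Set (ℕ × W)) (n : ℕ) : Set W :=
  Prod.mk n ⁻¹' s

namespace GraphModel

section RelativeInterpretation

variable (G : GraphModel.{u})

/-- The interpretation of a λ-term relative to a set `A` of points: the finite sets and the points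
quantified over in the clauses for application and abstraction are restricted to `A`. The set `A`
need not be closed under `G.code`, so that `A` may be finite. -/
def interpIn (A : Set G.Web) : LambdaTerm → (ℕ → Set G.Web) → Set G.Web
  | .var x, ρ => ρ x
  | .app M N, ρ => {α | ∃ a : Finset G.Web, (a : Set G.Web) ⊆ A ∧
      (a : Set G.Web) ⊆ interpIn A N ρ ∧ G.code (a, α) ∈ interpIn A M ρ}
  | .lam x M, ρ => {γ | ∃ (a : Finset G.Web) (α : G.Web), (a : Set G.Web) ⊆ A ∧ α ∈ A ∧
      α ∈ interpIn A M (Function.update ρ x a) ∧ γ = G.code (a, α)}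

theorem interpIn_univ (M : LambdaTerm) (ρ : ℕ → Set G.Web) :
    G.interpIn Set.univ M ρ = G.interp M ρ := by
  induction M generalizing ρ with
  | var x => rfl
  | app M N ihM ihN => simp [interpIn, interp, app, ihM, ihN]
  | lam x M ih => simp [interpIn, interp, abs, ih]

variable {G}

theorem interpIn_mono (M : LambdaTerm) {A B : Set G.Web} (hAB : A ⊆ B) {ρ σ : ℕ → Set G.Web}
    (hρσ : ρ ≤ σ) : G.interpIn A M ρ ⊆ G.interpIn B M σ := by
  induction M generalizing ρ σ with
  | var x => exact hρσ x
  | app M N ihM ihN =>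
    rintro α ⟨a, ha, haN, hM⟩
    exact ⟨a, ha.trans hAB, haN.trans (ihN hρσ), ihM hρσ hM⟩
  | lam x M ih =>
    rintro _ ⟨a, α, ha, hα, hM, rfl⟩
    exact ⟨a, α, ha.trans hAB, hAB hα,
      ih (update_le_update_iff.2 ⟨le_rfl, fun y _ => hρσ y⟩) hM, rfl⟩

theorem interpIn_subset_interp (A : Set G.Web) (M : LambdaTerm) (ρ : ℕ → Set G.Web) :
    G.interpIn A M ρ ⊆ G.interp M ρ :=
  G.interpIn_univ M ρ ▸ interpIn_mono M (Set.subset_univ A) le_rfl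

theorem interp_mono (M : LambdaTerm) : Monotone (G.interp M) := fun ρ σ h => by
  simpa only [interpIn_univ] using interpIn_mono M (Set.Subset.refl Set.univ) h

/-- A finite set of pairs serves both as an environment and, through its second projection, as a set
of points, so that one filter takes care of all the finite unions in the continuity argument. -/
theorem eventually_mem_interpIn (M : LambdaTerm) {ρ : ℕ → Set G.Web} {α : G.Web}
    (hα : α ∈ G.interp M ρ) : ∀ᶠ e : Finset (ℕ × G.Web) in atTop,
      α ∈ G.interpIn (Prod.snd '' (e : Set (ℕ × G.Web))) M (ρ ⊓ envOfGraph e) := by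
  have eventually_mem (n : ℕ) (w : G.Web) : ∀ᶠ e : Finset (ℕ × G.Web) in atTop, (n, w) ∈ e := by
    simpa using eventually_ge_atTop ({(n, w)} : Finset (ℕ × G.Web))
  have eventually_subset (a : Finset G.Web) : ∀ᶠ e : Finset (ℕ × G.Web) in atTop,
      (a : Set G.Web) ⊆ Prod.snd '' (e : Set (ℕ × G.Web)) :=
    a.eventually_all.2 fun w _ => (eventually_mem 0 w).mono fun e he => ⟨_, he, rfl⟩
  induction M generalizing ρ α with
  | var x => exact (eventually_mem x α).mono fun e he => ⟨hα, he⟩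
  | app M N ihM ihN =>
    obtain ⟨a, haN, hM⟩ := hα
    filter_upwards [ihM hM, a.eventually_all.2 fun w hw => ihN (haN hw), eventually_subset a]
      with e heM heN hea
    exact ⟨a, hea, heN, heM⟩
  | lam x M ih =>
    obtain ⟨a, α, hM, rfl⟩ := hα
    filter_upwards [ih hM, eventually_subset a, eventually_mem 0 α] with e heM hea heα
    have update_inf_le : Function.update ρ x (a : Set G.Web) ⊓ envOfGraph e ≤
        Function.update (ρ ⊓ envOfGraph e) x a :=
      le_update_iff.2 ⟨by simp, fun y hy => by simp [hy]⟩
    exact ⟨a, α, hea, ⟨_, heα, rfl⟩, interpIn_mono M Set.Subset.rfl update_inf_le heM, rfl⟩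

theorem exists_finset_mem_interpIn (M : LambdaTerm) {ρ : ℕ → Set G.Web} {α : G.Web}
    (hα : α ∈ G.interp M ρ) : ∃ (B : Finset G.Web) (e : Finset (ℕ × G.Web)),
      envOfGraph e ≤ ρ ∧ α ∈ G.interpIn B M (envOfGraph e) := by
  classical
  obtain ⟨e, he⟩ := (eventually_mem_interpIn M hα).exists
  refine ⟨e.image Prod.snd, e.filter fun p => p.2 ∈ ρ p.1, fun n w hw => ?_, ?_⟩
  · exact (Finset.mem_filter.1 hw).2
  · refine interpIn_mono M (by simp) (fun n w hw => ?_) he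
    exact Finset.mem_filter.2 ⟨hw.2, hw.1⟩

end RelativeInterpretation

/-- A set of points closed under codes on which the relative interpretation is the restriction of
the interpretation. This is the analogue of being the universe of an elementary substructure. -/
structure IsElementary (G : GraphModel.{u}) (A : Set G.Web) : Prop where
  code_mem : ∀ (a : Finset G.Web) (α : G.Web), (a : Set G.Web) ⊆ A → α ∈ A → G.code (a, α) ∈ A
  mem_interpIn : ∀ (M : LambdaTerm) (ρ : ℕ → Set G.Web) (α : G.Web), (∀ n, ρ n ⊆ A) → α ∈ A →
    α ∈ G.interp M ρ → α ∈ G.interpIn A M ρ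

theorem IsElementary.mem_interpIn_iff {G : GraphModel.{u}} {A : Set G.Web} (hA : G.IsElementary A)
    (M : LambdaTerm) {ρ : ℕ → Set G.Web} {α : G.Web} (hρ : ∀ n, ρ n ⊆ A) (hα : α ∈ A) :
    α ∈ G.interpIn A M ρ ↔ α ∈ G.interp M ρ :=
  ⟨fun h => interpIn_subset_interp A M ρ h, hA.mem_interpIn M ρ α hρ hα⟩

theorem exists_countable_isElementary (G : GraphModel.{u}) {C : Set G.Web} (hC : C.Countable) :
    ∃ A : Set G.Web, A.Countable ∧ C ⊆ A ∧ G.IsElementary A := by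
  classical
  have exists_support (M : LambdaTerm) (e : Finset (ℕ × G.Web)) (α : G.Web)
      (hα : α ∈ G.interp M (envOfGraph e)) :
      ∃ B : Finset G.Web, α ∈ G.interpIn B M (envOfGraph e) :=
    let ⟨B, _, he', hB⟩ := exists_finset_mem_interpIn M hα
    ⟨B, interpIn_mono M Set.Subset.rfl he' hB⟩
  choose! support mem_interpIn_support using exists_support
  let codes (F : Finset G.Web) : Finset G.Web := (F.powerset ×ˢ F).image G.code
  let envs (F : Finset G.Web) : Set (Finset (ℕ × G.Web)) :=
    {e | (e : Set (ℕ × G.Web)) ⊆ Set.univ ×ˢ (F : Set G.Web)}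
  let Φ (F : Finset G.Web) : Set G.Web :=
    codes F ∪ ⋃ (M : LambdaTerm), ⋃ e ∈ envs F, ⋃ α ∈ F, (support M e α : Set G.Web)
  have Φ_countable (F : Finset G.Web) : (Φ F).Countable :=
    (codes F).countable_toSet.union <| Set.countable_iUnion fun M =>
      (countable_ofPred_finset_coe_subset (Set.countable_univ.prod F.countable_toSet)).biUnion
        fun e _ => F.countable_toSet.biUnion fun α _ => (support M e α).countable_toSet
  obtain ⟨A, hA, hCA, Φ_subset⟩ := exists_countable_superset_closed Φ_countable hC
  refine ⟨A, hA, hCA, fun a α ha hα => ?_, fun M ρ α hρ hα h => ?_⟩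
  · have code_mem : G.code (a, α) ∈ codes (insert α a) :=
      Finset.mem_image_of_mem _ (by simp)
    refine Φ_subset (insert α a) ?_ (.inl code_mem)
    simpa [Set.insert_subset_iff] using ⟨hα, ha⟩
  · obtain ⟨_, e, heρ, hB⟩ := exists_finset_mem_interpIn M h
    let F := insert α (e.image Prod.snd)
    have hF : (F : Set G.Web) ⊆ A := by
      have image_subset : Prod.snd '' (e : Set (ℕ × G.Web)) ⊆ A := by
        rintro _ ⟨⟨n, w⟩, hw, rfl⟩
        exact hρ n (heρ n hw)
      simpa [F, Set.insert_subset_iff] using ⟨hα, by simpa using image_subset⟩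
    have he : e ∈ envs F := fun p hp =>
      ⟨trivial, Finset.mem_insert_of_mem (Finset.mem_image_of_mem _ hp)⟩
    have support_subset : (support M e α : Set G.Web) ⊆ Φ F := fun w hw => .inr <| by
      simp only [Set.mem_iUnion]
      exact ⟨M, e, he, α, Finset.mem_insert_self _ _, hw⟩
    exact interpIn_mono M (support_subset.trans (Φ_subset F hF)) heρ
      (mem_interpIn_support M e α (interpIn_subset_interp _ M _ hB))

section Embedding

variable {G : GraphModel.{u}}

/-- Compatibility of an embedding of webs with the coding functions; together they are an embedding
of graph models. -/
def PreservesCode {G' : GraphModel.{v}} (f : G'.Web ↪ G.Web) : Prop :=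
  ∀ a α, f (G'.code (a, α)) = G.code (a.map f, f α)

/-- The graph model induced on the domain of an embedding whose range is closed under codes. -/
noncomputable def comap {W : Type v} [Nonempty W] (f : W ↪ G.Web)
    (hf : ∀ a α, G.code (Finset.map f a, f α) ∈ Set.range f) : GraphModel.{v} where
  Web := W
  nonempty := ‹Nonempty W›
  code p := (Equiv.ofInjective f f.injective).symm ⟨_, hf p.1 p.2⟩
  code_injective p q h := by
    have hcode := G.code_injective (Subtype.mk.inj (Equiv.injective _ h))
    rw [Prod.mk.injEq] at hcode
    exact Prod.ext (Finset.map_injective f hcode.1) (f.injective hcode.2)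

theorem preservesCode_comap {W : Type v} [Nonempty W] (f : W ↪ G.Web)
    (hf : ∀ a α, G.code (Finset.map f a, f α) ∈ Set.range f) :
    PreservesCode (G' := comap f hf) f :=
  fun _ _ => Equiv.apply_ofInjective_symm f.injective _

variable {G' : GraphModel.{v}} {f : G'.Web ↪ G.Web}

theorem PreservesCode.mem_interp_iff_mem_interpIn (hf : PreservesCode f) (M : LambdaTerm)
    (ρ : ℕ → Set G'.Web) (α : G'.Web) :
    α ∈ G'.interp M ρ ↔ f α ∈ G.interpIn (Set.range f) M fun n => f '' ρ n := by
  classical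
  have exists_map_eq {a : Finset G.Web} (ha : (a : Set G.Web) ⊆ Set.range f) :
      ∃ b : Finset G'.Web, b.map f = a := by
    simpa [Finset.map_eq_image, ← Set.image_univ, Finset.subset_set_image_iff] using ha
  induction M generalizing ρ α with
  | var x => exact f.injective.mem_set_image.symm
  | app M N ihM ihN =>
    constructor
    · rintro ⟨a, haN, hM⟩
      refine ⟨a.map f, by simp, ?_, hf a α ▸ (ihM ρ _).1 hM⟩
      rw [Finset.coe_map, Set.image_subset_iff]
      exact fun w hw => (ihN ρ w).1 (haN hw)
    · rintro ⟨a, ha, haN, hM⟩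
      obtain ⟨b, rfl⟩ := exists_map_eq ha
      refine ⟨b, fun w hw => (ihN ρ w).2 (haN (Finset.mem_map_of_mem f hw)), (ihM ρ _).2 ?_⟩
      rwa [hf]
  | lam x M ih =>
    have image_update (b : Finset G'.Web) :
        (fun n => f '' Function.update ρ x (b : Set G'.Web) n) =
          Function.update (fun n => f '' ρ n) x (b.map f : Set G.Web) := by
      rw [Finset.coe_map]
      exact Function.comp_update (Set.image f) ρ x b
    constructor
    · rintro ⟨a, α, hM, rfl⟩
      exact ⟨a.map f, f α, by simp, ⟨α, rfl⟩, image_update a ▸ (ih _ α).1 hM, hf a α⟩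
    · rintro ⟨a, _, ha, ⟨β, rfl⟩, hM, hα⟩
      obtain ⟨b, rfl⟩ := exists_map_eq ha
      exact ⟨b, β, (ih _ β).2 (image_update b ▸ hM), f.injective (hα.trans (hf b β).symm)⟩

theorem PreservesCode.mem_interp_iff (hf : PreservesCode f) (hA : G.IsElementary (Set.range f))
    (M : LambdaTerm) (ρ : ℕ → Set G'.Web) (α : G'.Web) :
    α ∈ G'.interp M ρ ↔ f α ∈ G.interp M fun n => f '' ρ n :=
  (hf.mem_interp_iff_mem_interpIn M ρ α).trans <|
    hA.mem_interpIn_iff M (fun n => Set.image_subset_range f (ρ n)) ⟨α, rfl⟩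

end Embedding

section Theories

variable {G : GraphModel.{u}}

/-- A set of points is separating if every inequation that fails in `G` fails at one of these points
in an environment that takes its values in the set. -/
def IsSeparating (G : GraphModel.{u}) (C : Set G.Web) : Prop :=
  ∀ p ∉ G.orderTheory, ∃ ρ : ℕ → Set G.Web, (∀ n, ρ n ⊆ C) ∧
    ∃ α ∈ C, α ∈ G.interp p.1 ρ ∧ α ∉ G.interp p.2 ρ

theorem IsSeparating.mono {C D : Set G.Web} (hC : G.IsSeparating C) (hCD : C ⊆ D) :
    G.IsSeparating D := fun p hp =>
  let ⟨ρ, hρ, α, hα, h⟩ := hC p hp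
  ⟨ρ, fun n => (hρ n).trans hCD, α, hCD hα, h⟩

theorem exists_countable_isSeparating (G : GraphModel.{u}) :
    ∃ C : Set G.Web, C.Countable ∧ G.IsSeparating C := by
  have exists_failure (p : {p // p ∉ G.orderTheory}) :
      ∃ (e : Finset (ℕ × G.Web)) (α : G.Web),
        α ∈ G.interp p.1.1 (envOfGraph e) ∧ α ∉ G.interp p.1.2 (envOfGraph e) := by
    obtain ⟨p, hp⟩ := p
    simp only [orderTheory, Set.mem_ofPred_eq, not_forall, Set.not_subset] at hp
    obtain ⟨ρ, α, hα, hα'⟩ := hp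
    obtain ⟨_, e, he, hB⟩ := exists_finset_mem_interpIn p.1 hα
    exact ⟨e, α, interpIn_subset_interp _ _ _ hB, fun h => hα' (interp_mono p.2 he h)⟩
  choose e α hα using exists_failure
  refine ⟨⋃ p, insert (α p) (Prod.snd '' (e p : Set (ℕ × G.Web))), Set.countable_iUnion fun p =>
    ((e p).countable_toSet.image _).insert _, fun p hp => ?_⟩
  refine ⟨envOfGraph (e ⟨p, hp⟩), fun n w hw => ?_, α ⟨p, hp⟩, ?_, hα ⟨p, hp⟩⟩
  · exact Set.mem_iUnion.2 ⟨⟨p, hp⟩, .inr ⟨(n, w), hw, rfl⟩⟩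
  · exact Set.mem_iUnion.2 ⟨⟨p, hp⟩, Set.mem_insert _ _⟩

theorem PreservesCode.orderTheory_eq {G' : GraphModel.{v}} {f : G'.Web ↪ G.Web}
    (hf : PreservesCode f) (hA : G.IsElementary (Set.range f))
    (hsep : G.IsSeparating (Set.range f)) : G'.orderTheory = G.orderTheory := by
  ext p
  constructor
  · refine fun hp => by_contra fun hp' => ?_
    obtain ⟨ρ, hρ, _, ⟨α, rfl⟩, h, h'⟩ := hsep p hp'
    have image_preimage : (fun n => f '' (f ⁻¹' ρ n)) = ρ :=
      funext fun n => Set.image_preimage_eq_of_subset (hρ n)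
    have mem_interp_preimage_iff (M : LambdaTerm) :
        α ∈ G'.interp M (fun n => f ⁻¹' ρ n) ↔ f α ∈ G.interp M ρ := by
      rw [hf.mem_interp_iff hA, image_preimage]
    exact h' ((mem_interp_preimage_iff _).1 (hp _ ((mem_interp_preimage_iff _).2 h)))
  · exact fun hp ρ α hα =>
      (hf.mem_interp_iff hA p.2 ρ α).2 (hp _ ((hf.mem_interp_iff hA p.1 ρ α).1 hα))

theorem mem_eqTheory_iff {p : LambdaTerm × LambdaTerm} :
    p ∈ G.eqTheory ↔ p ∈ G.orderTheory ∧ p.swap ∈ G.orderTheory := by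
  simp only [eqTheory, orderTheory, Set.mem_ofPred_eq, Prod.fst_swap, Prod.snd_swap, ← forall_and,
    Set.Subset.antisymm_iff]

theorem eqTheory_eq_of_orderTheory_eq {G' : GraphModel.{v}} (h : G'.orderTheory = G.orderTheory) :
    G'.eqTheory = G.eqTheory := by
  ext p
  rw [mem_eqTheory_iff, mem_eqTheory_iff, h]

end Theories

end GraphModel

theorem mainTheorem12 (G : GraphModel.{u}) :
    ∃ G' : GraphModel.{0}, Countable G'.Web ∧
      G'.orderTheory = G.orderTheory ∧ G'.eqTheory = G.eqTheory := by
  obtain ⟨x⟩ := G.nonempty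
  obtain ⟨C, hC, hsep⟩ := G.exists_countable_isSeparating
  obtain ⟨A, hA, hCA, helem⟩ := G.exists_countable_isElementary (hC.insert x)
  rw [Set.insert_subset_iff] at hCA
  obtain ⟨W, f, hW, rfl⟩ := exists_embedding_range_eq_of_countable hA
  have : Nonempty W := Set.range_nonempty_iff_nonempty.1 ⟨x, hCA.1⟩
  have hf (a : Finset W) (α : W) : G.code (a.map f, f α) ∈ Set.range f :=
    helem.code_mem _ _ (by simp) ⟨α, rfl⟩
  have horder : (GraphModel.comap f hf).orderTheory = G.orderTheory :=
    (GraphModel.preservesCode_comap f hf).orderTheory_eq helem (hsep.mono hCA.2)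
  exact ⟨GraphModel.comap f hf, hW, horder, GraphModel.eqTheory_eq_of_orderTheory_eq horder⟩
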